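/- Let $m\ge 2$ be an integer. Let $P_{-4,n}(c)$, $n\ge 0$, be the polynomials in $c$ determined by $P_{-4,0}=1$, $P_{-4,1}=P_{-4,2}=P_{-4,3}=0$ and $$(km+m+4)\,P_{-4,k+4}(c)=2c\,\big((k-1)m+2\big)\,P_{-4,k+2}(c)-(k-3)m\,P_{-4,k}(c)\qquad(k\ge 0).$$ Then the series $P_{-4}(c,z)=\sum_{n\ge 0}P_{-4,n}(c)z^n$ converges for all $(c,z)\in(-1,1)\times(-1,1)$, its sum is $C^\infty$ there, and the following hold. 1. (Superelliptic integral.) For $(c,z)\in(-1,1)\times(0,1)$ the limit below exists and $$P_{-4}(c,z)=z^{3-4/m}(1-2cz^2+z^4)^{1/m}\lim_{\epsilon\to 0^+}\left[\int_\epsilon^z\frac{4-3m+2c(3m-2)w^2}{m\,w^{4-4/m}(1-2cw^2+w^4)^{1+1/m}}\,dw+\epsilon^{4/m-3}+\frac{2c}{m}\,\epsilon^{4/m-1}\right].$$ 2. (PDE.) With $v=\ln z$, so that $\frac{\partial}{\partial v}=z\frac{\partial}{\partial z}$, for all $(c,z)\in(-1,1)\times(0,1)$ $$0=m^2\left[4(1-c^2)\frac{\partial^2}{\partial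 c^2}-12c\frac{\partial}{\partial c}+\frac{\partial^2}{\partial v^2}+2\Big(\frac2m-3\Big)\frac{\partial}{\partial v}+4\Big(1-\frac2m\Big)\right]^2P_{-4}+16(m^2-8m)\frac{\partial^2P_{-4}}{\partial c^2}-16(2-m)^2\Big(c\frac{\partial}{\partial c}+1\Big)^2P_{-4},$$ where the square of an operator is its composition with itself. 3. (Boundary conditions.) For all $c\in(-1,1)$, $$P_{-4}(c,0)=1,\qquad \frac{\partial P_{-4}}{\partial z}(c,0)=\frac{\partial^2P_{-4}}{\partial z^2}(c,0)=\frac{\partial^3P_{-4}}{\partial z^3}(c,0)=0.$$ -/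

import Mathlib

open scoped Topology ContDiff

noncomputable section

/-- The polynomials `P_{-4,n}` in `c`, reindexed so that `pPoly m n` is the coefficient of `z ^ n`
in the generating function. They are determined by the initial values `1, 0, 0, 0` and the
recursion proved in `pPoly_recursion`. -/
def pPoly (m : ℕ) : ℕ → Polynomial ℝ
  | 0 => 1
  | 1 => 0
  | 2 => 0
  | 3 => 0
  | k + 4 =>
      Polynomial.C (((k : ℝ) * m + m + 4)⁻¹) *
        (Polynomial.C (2 * (((k : ℝ) - 1) * m + 2)) * Polynomial.X * pPoly m (k + 2)
          - Polynomial.C (((k : ℝ) - 3) * m) * pPoly m k)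

/-- The defining recursion, free of division:
`(k m + m + 4) P_{k+4} = 2 c ((k - 1) m + 2) P_{k+2} - (k - 3) m P_k` for `k ≥ 0`. -/
theorem pPoly_recursion (m k : ℕ) :
    Polynomial.C ((k : ℝ) * m + m + 4) * pPoly m (k + 4) =
      Polynomial.C (2 * (((k : ℝ) - 1) * m + 2)) * Polynomial.X * pPoly m (k + 2)
        - Polynomial.C (((k : ℝ) - 3) * m) * pPoly m k := by
  have h : ((k : ℝ) * m + m + 4) ≠ 0 := by positivity
  rw [pPoly, ← mul_assoc, ← Polynomial.C_mul, mul_inv_cancel₀ h, Polynomial.C_1, one_mul]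

/-- The generating function `P_{-4}(c, z) = ∑ P_{-4,n}(c) z ^ n`. -/
def genP (m : ℕ) (c z : ℝ) : ℝ := ∑' n : ℕ, (pPoly m n).eval c * z ^ n

/-- The quartic `1 - 2 c w ^ 2 + w ^ 4` of the superelliptic curve `u ^ m = 1 - 2 c w ^ 2 + w ^ 4`. -/
def quartic (c w : ℝ) : ℝ := 1 - 2 * c * w ^ 2 + w ^ 4

/-- The integrand of the superelliptic integral. -/
def superellipticIntegrand (m : ℕ) (c w : ℝ) : ℝ :=
  (4 - 3 * (m : ℝ) + 2 * c * (3 * (m : ℝ) - 2) * w ^ 2) /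
    ((m : ℝ) * w ^ (4 - 4 / (m : ℝ)) * quartic c w ^ (1 + 1 / (m : ℝ)))

/-- The partial derivative `∂/∂c` of a function of `(c, z)`. -/
def partialC (F : ℝ → ℝ → ℝ) : ℝ → ℝ → ℝ := fun c z => deriv (fun s => F s z) c

/-- The partial derivative `∂/∂v = z ∂/∂z`, where `v = ln z`, of a function of `(c, z)`. -/
def partialV (F : ℝ → ℝ → ℝ) : ℝ → ℝ → ℝ := fun c z => z * deriv (fun s => F c s) z

/-- The second-order operator
`4 (1 - c²) ∂²/∂c² - 12 c ∂/∂c + ∂²/∂v² + 2 (2/m - 3) ∂/∂v + 4 (1 - 2/m)`. -/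
def opA (m : ℕ) (F : ℝ → ℝ → ℝ) : ℝ → ℝ → ℝ := fun c z =>
  4 * (1 - c ^ 2) * partialC (partialC F) c z - 12 * c * partialC F c z
    + partialV (partialV F) c z + 2 * (2 / (m : ℝ) - 3) * partialV F c z
    + 4 * (1 - 2 / (m : ℝ)) * F c z

/-- The first-order operator `c ∂/∂c + 1`. -/
def opE (F : ℝ → ℝ → ℝ) : ℝ → ℝ → ℝ := fun c z => c * partialC F c z + F c z

end

/-!
Only the even coefficients `r_j = P_{-4,2j}` are nonzero, and the three facts about the generating
function come from three readings of their three-term recursion.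

*Convergence and smoothness.* Up to relative errors `O(1/j)` the recursion is the Chebyshev
recursion `y_{j+2} = 2c y_{j+1} - y_j`, whose characteristic roots have modulus one for
`c ∈ [-1, 1]`. Hence its solutions grow more slowly than any `R ^ j`, `R > 1`, uniformly in `c`
(`geomBounded_of_recursion`). The derivatives in `c` solve the same recursion with the lower
derivatives as a source, so they obey the same bounds
(`geomBounded_iterate_derivative_of_recursion`). Therefore the series may be differentiated
termwise to all orders on the open square (`contDiffOn_polySeries`), and the boundary conditions are
read off from the first four coefficients.

*Superelliptic integral.* Summing the recursion gives a first-order linear equation in `z`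
(`genP_ode`), with integrating factor `z ^ (4/m - 4) q ^ (-1 - 1/m)`, where `q` is the quartic: the
function `z ^ (4/m - 3) q ^ (-1/m) P` is a primitive of the superelliptic integrand. At `z = ε → 0`
it is `ε ^ (4/m - 3) + (2c/m) ε ^ (4/m - 1) + O(ε ^ (4/m + 1))` (`isBigO_rpow_mul_genP_sub`), and
the first two terms are exactly the counterterms of the regularised integral.

*Partial differential equation.* On the coefficient of `z ^ n` the operator `∂/∂v` acts as `n`, so
the claim is a fourth-order ordinary differential equation in `c` for each `P_{-4,n}`. The solutions
of the homogeneous recursion form a rank-two space, spanned by Gegenbauer functions, which carries a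
ladder operator for `d/dc`. With respect to it `r_j` behaves like a product `f_j g` in which `f_j`
solves a Gegenbauer equation depending on `j` and `g`, coming from the initial conditions, solves a
fixed one. The polynomials playing the roles of `f_j g`, `f_j' g`, `f_j g'` and `f_j' g'` are built
from `r_j` and a second solution `companionPoly` of the recursion; they form a closed first-order
system (`IsAssocRec.derivative_fst` and the three lemmas after it), because both sides of the
first two identities satisfy the recursion and agree at `j = 0, 1`. Eliminating three of the four
unknowns yields the fourth-order equation (`fourth_order_of_system`).
-/

open Polynomial

/-! ### Growth of solutions of perturbed Chebyshev recursions -/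

theorem exists_abs_eval_le (p : ℝ[X]) :
    ∃ M : ℝ, 0 ≤ M ∧ ∀ c ∈ Set.Icc (-1 : ℝ) 1, |p.eval c| ≤ M := by
  obtain ⟨M, hM⟩ := (isCompact_Icc (a := (-1 : ℝ)) (b := 1)).exists_bound_of_continuousOn
    (p.continuous.continuousOn)
  exact ⟨M, (norm_nonneg _).trans (hM 0 (by simp)), hM⟩

/-- A sequence of polynomials whose values on `[-1, 1]` grow slower than every geometric
progression of ratio greater than `1`, uniformly on the interval. -/
def GeomBounded (a : ℕ → ℝ[X]) : Prop :=
  ∀ R : ℝ, 1 < R → ∃ M : ℝ, ∀ n : ℕ, ∀ c ∈ Set.Icc (-1 : ℝ) 1, |(a n).eval c| ≤ M * R ^ n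

namespace GeomBounded

variable {a b : ℕ → ℝ[X]}

theorem add (ha : GeomBounded a) (hb : GeomBounded b) : GeomBounded (fun n => a n + b n) := by
  intro R hR
  obtain ⟨A, hA⟩ := ha R hR
  obtain ⟨B, hB⟩ := hb R hR
  refine ⟨A + B, fun n c hc => ?_⟩
  rw [eval_add, add_mul]
  exact (abs_add_le _ _).trans (add_le_add (hA n c hc) (hB n c hc))

theorem const_mul_of_le {u : ℕ → ℝ} {K : ℝ} (hu : ∀ n, |u n| ≤ K) (ha : GeomBounded a) :
    GeomBounded (fun n => C (u n) * a n) := by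
  intro R hR
  obtain ⟨A, hA⟩ := ha R hR
  refine ⟨K * A, fun n c hc => ?_⟩
  rw [eval_mul, eval_C, abs_mul, mul_assoc]
  exact mul_le_mul (hu n) (hA n c hc) (abs_nonneg _) ((abs_nonneg _).trans (hu 0))

theorem poly_mul (ha : GeomBounded a) (q : ℝ[X]) : GeomBounded (fun n => q * a n) := by
  intro R hR
  obtain ⟨A, hA⟩ := ha R hR
  obtain ⟨K, hK0, hK⟩ := exists_abs_eval_le q
  refine ⟨K * A, fun n c hc => ?_⟩
  rw [eval_mul, abs_mul, mul_assoc]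
  exact mul_le_mul (hK c hc) (hA n c hc) (abs_nonneg _) hK0

theorem succ (ha : GeomBounded a) : GeomBounded (fun n => a (n + 1)) := by
  intro R hR
  obtain ⟨A, hA⟩ := ha R hR
  refine ⟨A * R, fun n c hc => (hA (n + 1) c hc).trans_eq (by ring)⟩

/-- Multiplication of the `n`-th term by `n` is absorbed by an arbitrarily small increase of the
ratio, by Bernoulli's inequality. -/
theorem nat_mul (ha : GeomBounded a) : GeomBounded (fun n => C (n : ℝ) * a n) := by
  intro R hR
  set Q := √R with hQ
  have hQ1 : 1 < Q := by rw [hQ]; exact Real.lt_sqrt_of_sq_lt (by simpa using hR)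
  have hQQ : Q * Q = R := Real.mul_self_sqrt (by linarith)
  obtain ⟨A, hA⟩ := ha Q hQ1
  refine ⟨A / (Q - 1), fun n c hc => ?_⟩
  have hn : (n : ℝ) ≤ Q ^ n / (Q - 1) := by
    rw [le_div_iff₀ (by linarith)]
    have := one_add_mul_le_pow (a := Q - 1) (by linarith) n
    rw [add_sub_cancel] at this
    linarith
  rw [eval_mul, eval_C, abs_mul, Nat.abs_cast, ← hQQ, mul_pow]
  calc (n : ℝ) * |(a n).eval c| ≤ (Q ^ n / (Q - 1)) * (A * Q ^ n) :=
        mul_le_mul hn (hA n c hc) (abs_nonneg _)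
          (div_nonneg (pow_nonneg (by linarith) _) (by linarith))
    _ = _ := by ring

end GeomBounded

/-- Write `X² - 2cX + 1 = (X - u) (X - v)` with `v` the conjugate of `u` and `|u| = 1`. Then
`d j = y (j + 1) - u * y j` satisfies `d (j + 1) = v * d j` up to small errors, and the bounds
`|y j| ≤ A R ^ j`, `|d j| ≤ A (R - 1) R ^ j` are inherited from `j` to `j + 1`. -/
theorem abs_le_of_perturbed_recursion {R δ K A c : ℝ} (hR : 1 < R) (hc : c ∈ Set.Icc (-1 : ℝ) 1)
    (hδ0 : 0 ≤ δ) (hδ : δ * (3 * R) ≤ (R - 1) ^ 2 / 2) (hK : K ≤ A * (R - 1) ^ 2 / 2)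
    {α β s y : ℕ → ℝ} (hα : ∀ j, |α j| ≤ δ) (hβ : ∀ j, |β j| ≤ δ) (hs : ∀ j, |s j| ≤ K * R ^ j)
    (h0 : |y 0| ≤ A) (h1 : |y 0| + |y 1| ≤ A * (R - 1))
    (hy : ∀ j, y (j + 2) = 2 * c * (1 + α j) * y (j + 1) - (1 + β j) * y j + s j) (j : ℕ) :
    |y j| ≤ A * R ^ j := by
  set u : ℂ := ⟨c, √(1 - c ^ 2)⟩ with hu
  have hsq : √(1 - c ^ 2) * √(1 - c ^ 2) = 1 - c ^ 2 :=
    Real.mul_self_sqrt (by nlinarith [hc.1, hc.2])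
  have hc1 : |c| ≤ 1 := abs_le.2 hc
  have hunorm : ‖u‖ = 1 := by
    have : ‖u‖ ^ 2 = 1 := by
      rw [← Complex.normSq_eq_norm_sq, Complex.normSq_mk, hsq]; ring
    exact (pow_eq_one_iff_of_nonneg (norm_nonneg u) two_ne_zero).1 this
  set v : ℂ := (starRingEnd ℂ) u with hv
  have hvnorm : ‖v‖ = 1 := by rw [hv, RCLike.norm_conj, hunorm]
  have huv : u * v = 1 := by rw [hv, Complex.mul_conj, Complex.normSq_mk, hsq]; push_cast; ring
  have hadd : u + v = 2 * c := by rw [hv, Complex.add_conj]; simp [hu]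
  have hA : 0 ≤ A := (abs_nonneg _).trans h0
  have key : ∀ j, |y j| ≤ A * R ^ j ∧ ‖(y (j + 1) : ℂ) - u * y j‖ ≤ A * (R - 1) * R ^ j := by
    intro j
    induction j with
    | zero =>
      refine ⟨by simpa using h0, ?_⟩
      calc ‖(y (0 + 1) : ℂ) - u * y 0‖ ≤ ‖(y 1 : ℂ)‖ + ‖u * (y 0 : ℂ)‖ := norm_sub_le _ _
        _ = |y 0| + |y 1| := by
            rw [norm_mul, hunorm, Complex.norm_real, Complex.norm_real, Real.norm_eq_abs,
              Real.norm_eq_abs]; ring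
        _ ≤ _ := by simpa using h1
    | succ j ih =>
      obtain ⟨ih1, ih2⟩ := ih
      have hRj : 0 ≤ R ^ j := pow_nonneg (by linarith) _
      have hy1 : |y (j + 1)| ≤ A * R ^ (j + 1) := by
        have e : (y (j + 1) : ℂ) = ((y (j + 1) : ℂ) - u * y j) + u * y j := by ring
        calc |y (j + 1)| = ‖(y (j + 1) : ℂ)‖ := by rw [Complex.norm_real, Real.norm_eq_abs]
          _ ≤ ‖(y (j + 1) : ℂ) - u * y j‖ + ‖u * (y j : ℂ)‖ := by
              conv_lhs => rw [e]
              exact norm_add_le _ _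
          _ ≤ A * (R - 1) * R ^ j + A * R ^ j := by
              rw [norm_mul, hunorm, Complex.norm_real, Real.norm_eq_abs]; linarith
          _ = A * R ^ (j + 1) := by ring
      refine ⟨hy1, ?_⟩
      have e : (y (j + 1 + 1) : ℂ) - u * y (j + 1) = v * ((y (j + 1) : ℂ) - u * y j)
          + ((2 * c * α j * y (j + 1) - β j * y j + s j : ℝ) : ℂ) := by
        rw [show j + 1 + 1 = j + 2 from rfl, hy j]
        push_cast
        linear_combination (-(y (j + 1) : ℂ)) * hadd + (y j : ℂ) * huv
      have herr : |2 * c * α j * y (j + 1) - β j * y j + s j|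
          ≤ A * ((R - 1) ^ 2 / 2) * R ^ j + K * R ^ j := by
        have t1 : |2 * c * α j * y (j + 1)| ≤ 2 * 1 * δ * (A * R ^ (j + 1)) := by
          rw [abs_mul, abs_mul, abs_mul, abs_two]
          have := hα j
          gcongr
        have t2 : |β j * y j| ≤ δ * (A * R ^ j) := by
          rw [abs_mul]
          exact mul_le_mul (hβ j) ih1 (abs_nonneg _) hδ0
        have t3 : δ * (A * R ^ j) ≤ δ * (A * R ^ (j + 1)) := by
          gcongr
          · exact hR.le
          · exact Nat.le_succ j
        have t4 := mul_le_mul_of_nonneg_left hδ (mul_nonneg hA hRj)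
        calc _ ≤ |2 * c * α j * y (j + 1)| + |β j * y j| + |s j| :=
              (abs_add_le _ _).trans (add_le_add_left (abs_sub _ _) _)
          _ ≤ _ := by
              have := hs j
              rw [pow_succ] at t1 t3
              nlinarith
      calc _ ≤ ‖v * ((y (j + 1) : ℂ) - u * y j)‖
            + ‖((2 * c * α j * y (j + 1) - β j * y j + s j : ℝ) : ℂ)‖ := by
              rw [e]; exact norm_add_le _ _
        _ ≤ A * (R - 1) * R ^ j + (A * ((R - 1) ^ 2 / 2) * R ^ j + K * R ^ j) := by
              rw [norm_mul, hvnorm, one_mul, Complex.norm_real, Real.norm_eq_abs]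
              exact add_le_add ih2 herr
        _ ≤ A * (R - 1) * R ^ j
            + (A * ((R - 1) ^ 2 / 2) * R ^ j + (A * (R - 1) ^ 2 / 2) * R ^ j) := by gcongr
        _ = _ := by ring
  exact (key j).1

/-- Solutions of a three-term recursion that is an asymptotically vanishing perturbation of the
Chebyshev recursion are geometrically bounded with every ratio above `1`, because the roots of
`X² - 2cX + 1` have modulus one for `c ∈ [-1, 1]`. -/
theorem geomBounded_of_recursion {α β : ℕ → ℝ} (hα : Filter.Tendsto α Filter.atTop (𝓝 0))
    (hβ : Filter.Tendsto β Filter.atTop (𝓝 0)) {a s : ℕ → ℝ[X]} (hs : GeomBounded s)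
    (h : ∀ j, a (j + 2) = C (2 * (1 + α j)) * X * a (j + 1) - C (1 + β j) * a j + s j) :
    GeomBounded a := by
  intro R hR
  obtain ⟨K, hK⟩ := hs R hR
  set δ := (R - 1) ^ 2 / 2 / (3 * R) with hδ
  have hδpos : 0 < δ := by have : 0 < R - 1 := by linarith
                           positivity
  have hev : ∀ᶠ j in Filter.atTop, |α j| ≤ δ ∧ |β j| ≤ δ := by
    have h1 := (tendsto_order.1 hα.abs).2 δ (by simpa using hδpos)
    have h2 := (tendsto_order.1 hβ.abs).2 δ (by simpa using hδpos)
    filter_upwards [h1, h2] with j hj1 hj2 using ⟨hj1.le, hj2.le⟩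
  obtain ⟨N, hN⟩ := Filter.eventually_atTop.1 hev
  choose M hM0 hM using fun j => exists_abs_eval_le (a j)
  have hR1 : 0 < R - 1 := by linarith
  -- `A` dominates the source term and the two starting values at index `N`.
  obtain ⟨A, hA1, hA2, hA3⟩ : ∃ A : ℝ, K * R ^ N ≤ A * (R - 1) ^ 2 / 2 ∧ M N ≤ A ∧
      M N + M (N + 1) ≤ A * (R - 1) := by
    refine ⟨max (K * R ^ N / ((R - 1) ^ 2 / 2)) (max (M N) ((M N + M (N + 1)) / (R - 1))),
      ?_, ?_, ?_⟩
    · rw [mul_div_assoc, ← div_le_iff₀ (by positivity)]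
      exact le_max_left _ _
    · exact (le_max_left _ _).trans (le_max_right _ _)
    · rw [← div_le_iff₀ hR1]
      exact (le_max_right _ _).trans (le_max_right _ _)
  have hA0 : 0 ≤ A := (hM0 N).trans hA2
  refine ⟨(∑ j ∈ Finset.range N, M j) + A, fun n c hc => ?_⟩
  have hsum0 : 0 ≤ ∑ j ∈ Finset.range N, M j := Finset.sum_nonneg fun j _ => hM0 j
  rcases lt_or_ge n N with hn | hn
  · calc |(a n).eval c| ≤ M n := hM n c hc
      _ ≤ ∑ j ∈ Finset.range N, M j :=
          Finset.single_le_sum (fun j _ => hM0 j) (Finset.mem_range.2 hn)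
      _ ≤ ((∑ j ∈ Finset.range N, M j) + A) * 1 := by linarith
      _ ≤ _ := by gcongr; exact one_le_pow₀ hR.le
  · obtain ⟨j, rfl⟩ := Nat.exists_eq_add_of_le hn
    have := abs_le_of_perturbed_recursion (R := R) (δ := δ) (K := K * R ^ N) (A := A) (c := c)
      (α := fun j => α (N + j)) (β := fun j => β (N + j)) (s := fun j => (s (N + j)).eval c)
      (y := fun j => (a (N + j)).eval c) hR hc hδpos.le
      (by rw [hδ, div_mul_cancel₀]; positivity) hA1
      (fun j => (hN _ (Nat.le_add_right _ _)).1) (fun j => (hN _ (Nat.le_add_right _ _)).2)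
      (fun j => (hK _ c hc).trans_eq (by ring)) ((hM _ c hc).trans hA2)
      ((add_le_add (hM _ c hc) (hM _ c hc)).trans hA3)
      (fun j => by
        have := congrArg (eval c) (h (N + j))
        simp only [eval_add, eval_sub, eval_mul, eval_C, eval_X] at this
        rw [show N + (j + 2) = N + j + 2 from rfl, this, show N + (j + 1) = N + j + 1 from rfl]
        ring) j
    calc _ ≤ A * R ^ j := this
      _ ≤ ((∑ j ∈ Finset.range N, M j) + A) * R ^ (N + j) := by
          gcongr
          · linarith
          · exact hR.le
          · exact Nat.le_add_left _ _

/-- A sequence of polynomials all of whose derivative sequences are geometrically bounded with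
every ratio above `1`. -/
def SmoothlyBounded (a : ℕ → ℝ[X]) : Prop :=
  ∀ k : ℕ, GeomBounded (fun n => derivative^[k] (a n))

/-- Differentiating the recursion gives the same recursion for the derivatives, with the lower
derivatives in the source term. -/
theorem geomBounded_iterate_derivative_of_recursion {α β : ℕ → ℝ}
    (hα : Filter.Tendsto α Filter.atTop (𝓝 0)) (hβ : Filter.Tendsto β Filter.atTop (𝓝 0)) (k : ℕ) :
    ∀ {a s : ℕ → ℝ[X]}, (∀ i ≤ k, GeomBounded (fun n => derivative^[i] (s n))) →
    (∀ j, a (j + 2) = C (2 * (1 + α j)) * X * a (j + 1) - C (1 + β j) * a j + s j) →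
    ∀ i ≤ k, GeomBounded (fun n => derivative^[i] (a n)) := by
  induction k with
  | zero =>
    intro a s hs h i hi
    obtain rfl : i = 0 := by omega
    exact geomBounded_of_recursion hα hβ (hs 0 le_rfl) h
  | succ k ih =>
    intro a s hs h
    have h1 := ih (fun i hi => hs i (by omega)) h
    obtain ⟨K, hK⟩ : ∃ K, ∀ n, |2 * (1 + α n)| ≤ K := by
      have : Filter.Tendsto (fun n => 2 * (1 + α n)) Filter.atTop (𝓝 (2 * (1 + 0))) :=
        (hα.const_add 1).const_mul 2
      obtain ⟨K, hK⟩ := this.abs.bddAbove_range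
      exact ⟨K, fun n => hK ⟨n, rfl⟩⟩
    have h2 := ih (a := fun n => derivative (a n))
      (s := fun n => derivative (s n) + C (2 * (1 + α n)) * a (n + 1))
      (fun i hi => by
        have e : (fun n => derivative^[i] (derivative (s n) + C (2 * (1 + α n)) * a (n + 1)))
            = fun n => derivative^[i + 1] (s n)
              + C (2 * (1 + α n)) * derivative^[i] (a (n + 1)) := by
          funext n
          rw [iterate_map_add, iterate_derivative_C_mul, Function.iterate_succ_apply]
        rw [e]
        exact (hs (i + 1) (by omega)).add ((h1 i hi).succ.const_mul_of_le hK))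
      (fun j => by
        rw [h j]
        simp only [derivative_add, derivative_sub, derivative_mul, derivative_C, derivative_X]
        ring)
    intro i hi
    rcases i with _ | i
    · exact h1 0 (Nat.zero_le _)
    · simpa only [Function.iterate_succ_apply] using h2 i (by omega)

namespace SmoothlyBounded

variable {a b : ℕ → ℝ[X]}

theorem geomBounded (ha : SmoothlyBounded a) : GeomBounded a := ha 0

theorem derivative (ha : SmoothlyBounded a) :
    SmoothlyBounded (fun n => Polynomial.derivative (a n)) := fun k => ha (k + 1)

theorem add (ha : SmoothlyBounded a) (hb : SmoothlyBounded b) :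
    SmoothlyBounded (fun n => a n + b n) := fun k => by
  simpa only [iterate_map_add] using (ha k).add (hb k)

theorem nat_mul (ha : SmoothlyBounded a) : SmoothlyBounded (fun n => C (n : ℝ) * a n) :=
  fun k => by
  simpa only [iterate_derivative_C_mul] using (ha k).nat_mul

theorem poly_mul (ha : SmoothlyBounded a) (q : ℝ[X]) : SmoothlyBounded (fun n => q * a n) := by
  intro k
  induction k generalizing q a with
  | zero => exact (ha 0).poly_mul q
  | succ k ih =>
    simp only [Function.iterate_succ_apply, derivative_mul, iterate_map_add]
    exact (ih ha _).add (ih ha.derivative q)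

theorem succ (ha : SmoothlyBounded a) : SmoothlyBounded (fun n => a (n + 1)) := fun k => (ha k).succ

end SmoothlyBounded

/-! ### Power series in `z` with polynomial coefficients in `c` -/

/-- The coefficients of `∂/∂z` of the series with coefficients `a`. -/
noncomputable def shiftDeriv (a : ℕ → ℝ[X]) : ℕ → ℝ[X] := fun n => C ((n : ℝ) + 1) * a (n + 1)

theorem SmoothlyBounded.shiftDeriv {a : ℕ → ℝ[X]} (ha : SmoothlyBounded a) :
    SmoothlyBounded (shiftDeriv a) := by
  intro k
  simpa only [_root_.shiftDeriv, Nat.cast_add, Nat.cast_one] using ha.nat_mul.succ k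

/-- The function `∑ a_n(c) z ^ n` of two variables with polynomial coefficients `a`. -/
noncomputable def polySeries (a : ℕ → ℝ[X]) (c z : ℝ) : ℝ := ∑' n : ℕ, (a n).eval c * z ^ n

/-- The open square on which the series are studied. -/
def openSquare : Set (ℝ × ℝ) := Set.Ioo (-1 : ℝ) 1 ×ˢ Set.Ioo (-1 : ℝ) 1

theorem isOpen_openSquare : IsOpen openSquare := isOpen_Ioo.prod isOpen_Ioo

theorem GeomBounded.exists_bound {a : ℕ → ℝ[X]} (ha : GeomBounded a) {ρ : ℝ} (h0 : 0 < ρ)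
    (h1 : ρ < 1) : ∃ M r : ℝ, 0 ≤ r ∧ r < 1 ∧ ∀ n : ℕ, ∀ c ∈ Set.Icc (-1 : ℝ) 1,
      |(a n).eval c| * ρ ^ n ≤ M * r ^ n := by
  obtain ⟨R, hR1, hR2⟩ := exists_between ((one_lt_inv₀ h0).2 h1)
  obtain ⟨M, hM⟩ := ha R hR1
  -- `R < ρ⁻¹` makes the ratio `R * ρ` smaller than `1`.
  refine ⟨M, R * ρ, by positivity, ?_, fun n c hc => ?_⟩
  · calc R * ρ < ρ⁻¹ * ρ := by gcongr
      _ = 1 := inv_mul_cancel₀ h0.ne'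
  · calc _ ≤ M * R ^ n * ρ ^ n := by gcongr; exact hM n c hc
      _ = _ := by rw [mul_pow]; ring

theorem GeomBounded.summable {a : ℕ → ℝ[X]} (ha : GeomBounded a) {c z : ℝ}
    (hc : c ∈ Set.Ioo (-1 : ℝ) 1) (hz : z ∈ Set.Ioo (-1 : ℝ) 1) :
    Summable (fun n : ℕ => (a n).eval c * z ^ n) := by
  obtain ⟨ρ, hρ1, hρ2⟩ := exists_between (abs_lt.2 hz)
  have h0 : 0 < ρ := (abs_nonneg z).trans_lt hρ1
  obtain ⟨M, r, hr0, hr1, hM⟩ := ha.exists_bound h0 hρ2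
  refine Summable.of_norm_bounded ((summable_geometric_of_lt_one hr0 hr1).mul_left M) fun n => ?_
  rw [norm_mul, norm_pow, Real.norm_eq_abs, Real.norm_eq_abs]
  refine le_trans ?_ (hM n c (Set.Ioo_subset_Icc_self hc))
  gcongr

theorem polySeries_zero_right (a : ℕ → ℝ[X]) (c : ℝ) : polySeries a c 0 = (a 0).eval c := by
  rw [polySeries, tsum_eq_single 0 (fun n hn => by simp [hn])]
  simp

theorem mul_polySeries_shiftDeriv {a : ℕ → ℝ[X]} (ha : SmoothlyBounded a) {c z : ℝ}
    (hc : c ∈ Set.Ioo (-1 : ℝ) 1) (hz : z ∈ Set.Ioo (-1 : ℝ) 1) :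
    z * polySeries (shiftDeriv a) c z = polySeries (fun n => C (n : ℝ) * a n) c z := by
  rw [polySeries, polySeries, ← tsum_mul_left,
    (ha.nat_mul.geomBounded.summable hc hz).tsum_eq_zero_add]
  simp only [Nat.cast_zero, C_0, zero_mul, eval_zero, zero_add]
  refine tsum_congr fun n => ?_
  simp only [shiftDeriv, eval_mul, eval_C]
  push_cast
  ring

/-- Termwise differentiation of the series in both variables. -/
theorem hasFDerivAt_polySeries {a : ℕ → ℝ[X]} (ha : SmoothlyBounded a) {p : ℝ × ℝ}
    (hp : p ∈ openSquare) :
    HasFDerivAt (fun p : ℝ × ℝ => polySeries a p.1 p.2)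
      (polySeries (fun n => derivative (a n)) p.1 p.2 • ContinuousLinearMap.fst ℝ ℝ ℝ
        + polySeries (shiftDeriv a) p.1 p.2 • ContinuousLinearMap.snd ℝ ℝ ℝ) p := by
  obtain ⟨hc, hz⟩ := hp
  obtain ⟨ρ, hρ1, hρ2⟩ := exists_between (abs_lt.2 hz)
  have h0 : 0 < ρ := (abs_nonneg _).trans_lt hρ1
  obtain ⟨M, r, hr0, hr1, hM⟩ := ha.derivative.geomBounded.exists_bound h0 hρ2
  obtain ⟨M', r', hr0', hr1', hM'⟩ := ha.nat_mul.geomBounded.exists_bound h0 hρ2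
  set f' : ℕ → ℝ × ℝ → ℝ × ℝ →L[ℝ] ℝ := fun n q =>
    ((derivative (a n)).eval q.1 * q.2 ^ n) • ContinuousLinearMap.fst ℝ ℝ ℝ
      + ((a n).eval q.1 * ((n : ℝ) * q.2 ^ (n - 1))) • ContinuousLinearMap.snd ℝ ℝ ℝ with hf'
  have hu : Summable (fun n : ℕ => M * r ^ n + M' * r' ^ n / ρ) :=
    ((summable_geometric_of_lt_one hr0 hr1).mul_left M).add
      (((summable_geometric_of_lt_one hr0' hr1').mul_left M').div_const ρ)
  have hbound : ∀ n, ∀ q ∈ Set.Ioo (-1 : ℝ) 1 ×ˢ Set.Ioo (-ρ) ρ,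
      ‖f' n q‖ ≤ M * r ^ n + M' * r' ^ n / ρ := by
    intro n q hq
    have hq1 := Set.Ioo_subset_Icc_self hq.1
    have hq2 : |q.2| ≤ ρ := (abs_lt.2 hq.2).le
    have e1 : ‖(derivative (a n)).eval q.1 * q.2 ^ n‖ ≤ M * r ^ n := by
      rw [norm_mul, norm_pow, Real.norm_eq_abs, Real.norm_eq_abs]
      refine le_trans ?_ (hM n _ hq1)
      gcongr
    have e2 : ‖(a n).eval q.1 * ((n : ℝ) * q.2 ^ (n - 1))‖ ≤ M' * r' ^ n / ρ := by
      have := hM' n _ hq1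
      rw [eval_mul, eval_C, abs_mul, Nat.abs_cast] at this
      rw [le_div_iff₀ h0, norm_mul, norm_mul, norm_pow, Real.norm_eq_abs, Real.norm_natCast,
        Real.norm_eq_abs]
      refine le_trans ?_ this
      -- The factor `n` removes the truncated exponent `n - 1` at `n = 0`.
      rcases n with _ | n
      · simp
      · rw [Nat.add_sub_cancel, pow_succ]
        have : |q.2| ^ n ≤ ρ ^ n := by gcongr
        calc _ = ((n + 1 : ℕ) : ℝ) * |(a (n + 1)).eval q.1| * ρ * |q.2| ^ n := by ring
          _ ≤ ((n + 1 : ℕ) : ℝ) * |(a (n + 1)).eval q.1| * ρ * ρ ^ n := by gcongr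
          _ = _ := by ring
    have n1 := ContinuousLinearMap.norm_fst_le ℝ ℝ ℝ
    have n2 := ContinuousLinearMap.norm_snd_le ℝ ℝ ℝ
    calc ‖f' n q‖ ≤ _ := norm_add_le _ _
      _ ≤ M * r ^ n * 1 + M' * r' ^ n / ρ * 1 := by
          rw [norm_smul, norm_smul]
          gcongr
          · exact (norm_nonneg _).trans e1
          · exact (norm_nonneg _).trans e2
      _ = _ := by ring
  have hpmem : p ∈ Set.Ioo (-1 : ℝ) 1 ×ˢ Set.Ioo (-ρ) ρ := ⟨hc, abs_lt.1 hρ1⟩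
  have key := hasFDerivAt_tsum_of_isPreconnected
    (f := fun n (q : ℝ × ℝ) => (a n).eval q.1 * q.2 ^ n)
    (f' := f') hu (isOpen_Ioo.prod isOpen_Ioo) (isPreconnected_Ioo.prod isPreconnected_Ioo)
    (fun n q _ => by
      have d1 : HasFDerivAt (fun q : ℝ × ℝ => (a n).eval q.1)
          ((derivative (a n)).eval q.1 • ContinuousLinearMap.fst ℝ ℝ ℝ) q :=
        ((a n).hasDerivAt q.1).comp_hasFDerivAt q hasFDerivAt_fst
      have d2 : HasFDerivAt (fun q : ℝ × ℝ => q.2 ^ n)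
          (((n : ℝ) * q.2 ^ (n - 1)) • ContinuousLinearMap.snd ℝ ℝ ℝ) q :=
        (hasDerivAt_pow n q.2).comp_hasFDerivAt q hasFDerivAt_snd
      convert! d1.mul d2 using 1
      simp only [hf', smul_smul]
      rw [add_comm, mul_comm (eval q.1 (derivative (a n)))])
    hbound hpmem (ha.geomBounded.summable hc hz) hpmem
  convert! key using 1
  have s1 : HasSum (fun n : ℕ => (derivative (a n)).eval p.1 * p.2 ^ n)
      (polySeries (fun n => derivative (a n)) p.1 p.2) :=
    (ha.derivative.geomBounded.summable hc hz).hasSum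
  have s2 : HasSum (fun n : ℕ => (a n).eval p.1 * ((n : ℝ) * p.2 ^ (n - 1)))
      (polySeries (shiftDeriv a) p.1 p.2) := by
    rw [← hasSum_nat_add_iff' 1]
    have := (ha.shiftDeriv.geomBounded.summable hc hz).hasSum
    convert! this using 1
    · funext n
      simp only [shiftDeriv, eval_mul, eval_C, Nat.add_sub_cancel]
      push_cast
      ring
    · simp [polySeries]
  exact ((s1.smul_const _).add (s2.smul_const _)).tsum_eq.symm

theorem contDiffOn_polySeries {a : ℕ → ℝ[X]} (ha : SmoothlyBounded a) :
    ContDiffOn ℝ ∞ (fun p : ℝ × ℝ => polySeries a p.1 p.2) openSquare := by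
  rw [contDiffOn_infty]
  intro n
  induction n generalizing a with
  | zero =>
    exact contDiffOn_zero.2 fun p hp =>
      (hasFDerivAt_polySeries ha hp).continuousAt.continuousWithinAt
  | succ n ih =>
    refine (contDiffOn_succ_iff_hasFDerivWithinAt_of_uniqueDiffOn
      isOpen_openSquare.uniqueDiffOn).2
        ⟨fun h => absurd h (WithTop.coe_ne_top (a := (n : ℕ∞))), _, ?_, fun p hp =>
          (hasFDerivAt_polySeries ha hp).hasFDerivWithinAt⟩
    exact ((ih ha.derivative).smul contDiffOn_const).add
      ((ih ha.shiftDeriv).smul contDiffOn_const)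

theorem hasDerivAt_polySeries_left {a : ℕ → ℝ[X]} (ha : SmoothlyBounded a) {c z : ℝ}
    (hc : c ∈ Set.Ioo (-1 : ℝ) 1) (hz : z ∈ Set.Ioo (-1 : ℝ) 1) :
    HasDerivAt (fun s => polySeries a s z) (polySeries (fun n => derivative (a n)) c z) c := by
  have h := (hasFDerivAt_polySeries ha (p := (c, z)) ⟨hc, hz⟩).comp_hasDerivAt c
    ((hasDerivAt_id c).prodMk (hasDerivAt_const c z))
  simpa using! h

theorem hasDerivAt_polySeries_right {a : ℕ → ℝ[X]} (ha : SmoothlyBounded a) {c z : ℝ}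
    (hc : c ∈ Set.Ioo (-1 : ℝ) 1) (hz : z ∈ Set.Ioo (-1 : ℝ) 1) :
    HasDerivAt (fun s => polySeries a c s) (polySeries (shiftDeriv a) c z) z := by
  have h := (hasFDerivAt_polySeries ha (p := (c, z)) ⟨hc, hz⟩).comp_hasDerivAt z
    ((hasDerivAt_const z c).prodMk (hasDerivAt_id z))
  simpa using! h

theorem iteratedDeriv_polySeries_right {a : ℕ → ℝ[X]} (ha : SmoothlyBounded a) {c z : ℝ} (k : ℕ)
    (hc : c ∈ Set.Ioo (-1 : ℝ) 1) (hz : z ∈ Set.Ioo (-1 : ℝ) 1) :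
    iteratedDeriv k (fun s => polySeries a c s) z = polySeries (shiftDeriv^[k] a) c z := by
  have hsb : ∀ k, SmoothlyBounded (shiftDeriv^[k] a) := fun k => by
    induction k with
    | zero => exact ha
    | succ k ih => rw [Function.iterate_succ_apply']; exact ih.shiftDeriv
  induction k generalizing z with
  | zero => simp
  | succ k ih =>
    have hev : iteratedDeriv k (fun s => polySeries a c s) =ᶠ[𝓝 z]
        fun s => polySeries (shiftDeriv^[k] a) c s :=
      Filter.eventually_of_mem (isOpen_Ioo.mem_nhds hz) fun s hs => ih hs
    rw [iteratedDeriv_succ, hev.deriv_eq, (hasDerivAt_polySeries_right (hsb k) hc hz).deriv,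
      Function.iterate_succ_apply']

/-! ### The fourth-order equation for products of Gegenbauer functions -/

/-- The operator `4 (1 - c²) ∂² - 12 c ∂ + l` on polynomials in `c`. -/
noncomputable def polyOpA (l p : ℝ[X]) : ℝ[X] :=
  4 * (1 - X ^ 2) * derivative (derivative p) - 12 * X * derivative p + l * p

/-- The operator `c ∂ + 1` on polynomials in `c`. -/
noncomputable def polyOpE (p : ℝ[X]) : ℝ[X] := X * derivative p + p

/-- Products `r = f h` of solutions of two Gegenbauer equations
`(1 - c²) f'' = (1 - 2ι) c f' - (μ / 4) f` and `(1 - c²) h'' = (3 + 2ι) c h' + (3 / 4 + 3ι) h`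
satisfy a fourth-order equation. Here `b`, `s`, `g` play the roles of `2 (1 - c²) f' h`,
`2 (1 - c²) f h'` and `4 (1 - c²)² f' h'`, and the hypotheses are the closed linear system that
the two equations imply for them. -/
theorem fourth_order_of_system {ι μ : ℝ} {r b s g : ℝ[X]}
    (hr : 2 * (1 - X ^ 2) * derivative r = b + s)
    (hs : 2 * (1 - X ^ 2) * derivative s =
      g + (2 + 4 * C ι) * X * s + (3 + 12 * C ι) * (1 - X ^ 2) * r)
    (hb : 2 * (1 - X ^ 2) * derivative b =
      g - (2 + 4 * C ι) * X * b - C μ * (1 - X ^ 2) * r)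
    (hg : 2 * derivative g = (3 + 12 * C ι) * b - C μ * s) :
    polyOpA (C μ - 5 + 4 * C ι) (polyOpA (C μ - 5 + 4 * C ι) r)
      + 16 * (1 - 8 * C ι) * derivative (derivative r)
      - 16 * (2 * C ι - 1) ^ 2 * polyOpE (polyOpE r) = 0 := by
  -- Express `(2 (1 - c²)) ^ k r^{(k)}` for `k ≤ 4` in terms of `r, b, s, g`.
  have h1 := congrArg derivative hr
  simp only [derivative_add, derivative_sub, derivative_mul, derivative_X_pow, derivative_one,
    derivative_ofNat, map_ofNat, Nat.cast_ofNat] at h1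
  have e2 : (2 * (1 - X ^ 2)) ^ 2 * derivative (derivative r) =
      (3 - C μ + 12 * C ι) * (1 - X ^ 2) * r + (2 - 4 * C ι) * X * b + (6 + 4 * C ι) * X * s
        + 2 * g := by
    linear_combination (2 * (1 - X ^ 2)) * h1 + 4 * X * hr + hs + hb
  have h2 := congrArg derivative e2
  simp only [derivative_add, derivative_sub, derivative_mul, derivative_C, derivative_X,
    derivative_pow, derivative_one, derivative_ofNat, map_ofNat, Nat.cast_ofNat] at h2
  have e3 : (2 * (1 - X ^ 2)) ^ 3 * derivative (derivative (derivative r)) =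
      (30 - 6 * C μ + 132 * C ι + 4 * C ι * C μ + 48 * C ι ^ 2) * X * (1 - X ^ 2) * r
      + ((13 - C μ + 28 * C ι) + (-1 + C μ - 60 * C ι + 16 * C ι ^ 2) * X ^ 2) * b
      + ((15 - 3 * C μ + 20 * C ι) + (45 + 3 * C μ + 44 * C ι + 16 * C ι ^ 2) * X ^ 2) * s
      + 24 * X * g := by
    linear_combination (2 * (1 - X ^ 2)) * h2 + 8 * X * e2
      + (3 - C μ + 12 * C ι) * (1 - X ^ 2) * hr + (2 - 4 * C ι) * X * hb
      + (6 + 4 * C ι) * X * hs + 2 * (1 - X ^ 2) * hg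
  have h3 := congrArg derivative e3
  simp only [derivative_add, derivative_sub, derivative_mul, derivative_C, derivative_X,
    derivative_pow, derivative_one, derivative_neg, derivative_ofNat, map_ofNat,
    Nat.cast_ofNat] at h3
  have e4 : (2 * (1 - X ^ 2)) ^ 4 * derivative (derivative (derivative (derivative r))) =
      ((105 - 34 * C μ + C μ ^ 2 + 504 * C ι - 56 * C ι * C μ + 336 * C ι ^ 2)
        + (210 + 8 * C μ - 2 * C μ ^ 2 + 960 * C ι + 176 * C ι * C μ + 528 * C ι ^ 2
          - 16 * C ι ^ 2 * C μ + 192 * C ι ^ 3) * X ^ 2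
        + (-315 + 26 * C μ + C μ ^ 2 - 1464 * C ι - 120 * C ι * C μ - 864 * C ι ^ 2
          + 16 * C ι ^ 2 * C μ - 192 * C ι ^ 3) * X ^ 4) * r
      + ((228 - 12 * C μ + 408 * C ι + 8 * C ι * C μ) * X
        + (-108 + 12 * C μ - 776 * C ι - 8 * C ι * C μ + 288 * C ι ^ 2 - 64 * C ι ^ 3) * X ^ 3) * b
      + ((420 - 60 * C μ + 648 * C ι - 8 * C ι * C μ + 192 * C ι ^ 2) * X
        + (420 + 60 * C μ + 488 * C ι + 8 * C ι * C μ + 288 * C ι ^ 2 + 64 * C ι ^ 3) * X ^ 3) * s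
      + ((76 - 4 * C μ + 48 * C ι) + (284 + 4 * C μ - 16 * C ι + 32 * C ι ^ 2) * X ^ 2) * g := by
    linear_combination (2 * (1 - X ^ 2)) * h3 + 12 * X * e3
      + (30 - 6 * C μ + 132 * C ι + 4 * C ι * C μ + 48 * C ι ^ 2) * X * (1 - X ^ 2) * hr
      + ((13 - C μ + 28 * C ι) + (-1 + C μ - 60 * C ι + 16 * C ι ^ 2) * X ^ 2) * hb
      + ((15 - 3 * C μ + 20 * C ι) + (45 + 3 * C μ + 44 * C ι + 16 * C ι ^ 2) * X ^ 2) * hs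
      + 24 * X * (1 - X ^ 2) * hg
  have hw : (1 - X ^ 2 : ℝ[X]) ≠ 0 := fun h => by
    have := congrArg (eval 0) h
    simp at this
  have hw4 : 16 * (1 - X ^ 2 : ℝ[X]) ^ 4 ≠ 0 := mul_ne_zero (by norm_num) (pow_ne_zero _ hw)
  refine (mul_eq_zero.1 ?_).resolve_left hw4
  simp only [polyOpA, polyOpE, derivative_add, derivative_sub, derivative_mul, derivative_C,
    derivative_X, derivative_X_pow, derivative_one, derivative_ofNat, derivative_zero, map_ofNat,
    Nat.cast_ofNat, map_natCast]
  -- The factors below are the coefficients of `r^{(4)}, …, r'` in the expanded operator.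
  linear_combination 16 * (1 - X ^ 2) ^ 2 * e4 - 160 * (1 - X ^ 2) * X * (2 * (1 - X ^ 2)) * e3
    + (4 * (1 - X ^ 2) * (2 * (C μ - 5 + 4 * C ι) - 32) + 240 * X ^ 2 + 16 * (1 - 8 * C ι)
      - 16 * (2 * C ι - 1) ^ 2 * X ^ 2) * (2 * (1 - X ^ 2)) ^ 2 * e2
    + (-12 * X * (2 * (C μ - 5 + 4 * C ι) - 12) - 48 * (2 * C ι - 1) ^ 2 * X)
      * (2 * (1 - X ^ 2)) ^ 3 * hr

/-! ### The ladder operator on solutions of the recursion -/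

/-- The three-term recursion of `P_{-4,2j}` with `ι = 1 / m`. -/
def IsAssocRec (ι : ℝ) (y : ℕ → ℝ[X]) : Prop :=
  ∀ j : ℕ, (2 * (j : ℝ[X]) + 1 + 4 * C ι) * y (j + 2) =
    (4 * (j : ℝ[X]) - 2 + 4 * C ι) * X * y (j + 1) - (2 * (j : ℝ[X]) - 3) * y j

theorem IsAssocRec.eq_zero {ι : ℝ} (hι : 0 ≤ ι) {y : ℕ → ℝ[X]} (hy : IsAssocRec ι y)
    (h0 : y 0 = 0) (h1 : y 1 = 0) (j : ℕ) : y j = 0 := by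
  have key : ∀ j, y j = 0 ∧ y (j + 1) = 0 := by
    intro j
    induction j with
    | zero => exact ⟨h0, h1⟩
    | succ j ih =>
      refine ⟨ih.2, ?_⟩
      have h := hy j
      rw [ih.1, ih.2, mul_zero, mul_zero, sub_zero] at h
      refine (mul_eq_zero.1 h).resolve_left fun h' => ?_
      have := congrArg (eval 0) h'
      simp only [eval_add, eval_mul, eval_natCast, eval_ofNat, eval_C, eval_one, eval_zero] at this
      have : (0 : ℝ) < 2 * j + 1 + 4 * ι := by positivity
      linarith
  exact (key j).1

/-- Twice the ladder operator of the Gegenbauer functions, which expresses `(1 - c²) f'` by two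
neighbouring members of the family. -/
noncomputable def ladder (ι : ℝ) (y : ℕ → ℝ[X]) (j : ℕ) : ℝ[X] :=
  (2 * (j : ℝ[X]) - 3) * X * y j - (2 * (j : ℝ[X]) - 1 + 4 * C ι) * y (j + 1)

theorem IsAssocRec.derivative_eq {ι : ℝ} {y : ℕ → ℝ[X]} (hy : IsAssocRec ι y) (j : ℕ) :
    (2 * (j : ℝ[X]) + 1 + 4 * C ι) * derivative (y (j + 2)) =
      (4 * (j : ℝ[X]) - 2 + 4 * C ι) * (y (j + 1) + X * derivative (y (j + 1)))
        - (2 * (j : ℝ[X]) - 3) * derivative (y j) := by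
  have h := congrArg derivative (hy j)
  simp only [derivative_add, derivative_sub, derivative_mul, derivative_C, derivative_X,
    derivative_one, derivative_ofNat, derivative_natCast] at h
  linear_combination h

section System

variable {ι : ℝ} {r s : ℕ → ℝ[X]}

/-- The difference of the two sides solves the recursion. -/
theorem IsAssocRec.derivative_fst (hι : 0 < ι) (hr : IsAssocRec ι r) (hs : IsAssocRec ι s)
    (r0 : r 0 = 1) (r1 : r 1 = 0) (s0 : s 0 = 3 * X) (s1 : s 1 = 3) (j : ℕ) :
    2 * (1 - X ^ 2) * derivative (r j) = ladder ι r j + s j := by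
  have h : IsAssocRec ι (fun j => 2 * (1 - X ^ 2) * derivative (r j) - ladder ι r j - s j) := by
    intro j
    have a := hr j
    have b := hr (j + 1)
    have d := hr.derivative_eq j
    have e := hs j
    simp only [ladder]
    push_cast at b ⊢
    linear_combination 2 * (1 - X ^ 2) * d + (2 * (j : ℝ[X]) + 1 + 4 * C ι) * b
      + (3 - 2 * (j : ℝ[X])) * X * a - e
  have h2 := hr 0
  rw [r0, r1] at h2
  have := h.eq_zero hι.le (by simp [ladder, r0, r1, s0]) (by
    simp only [ladder, r1, s1]
    push_cast at h2 ⊢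
    simp only [derivative_zero]
    linear_combination h2) j
  linear_combination this

theorem IsAssocRec.derivative_snd (hι : 0 < ι) (hr : IsAssocRec ι r) (hs : IsAssocRec ι s)
    (r0 : r 0 = 1) (r1 : r 1 = 0) (s0 : s 0 = 3 * X) (s1 : s 1 = 3) (j : ℕ) :
    2 * (1 - X ^ 2) * derivative (s j) =
      ladder ι s j + (2 + 4 * C ι) * X * s j + (3 + 12 * C ι) * (1 - X ^ 2) * r j := by
  have h : IsAssocRec ι (fun j => 2 * (1 - X ^ 2) * derivative (s j) - ladder ι s j
      - (2 + 4 * C ι) * X * s j - (3 + 12 * C ι) * (1 - X ^ 2) * r j) := by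
    intro j
    have a := hs j
    have b := hs (j + 1)
    have d := hs.derivative_eq j
    have e := hr j
    simp only [ladder]
    push_cast at b ⊢
    linear_combination 2 * (1 - X ^ 2) * d + (2 * (j : ℝ[X]) + 1 + 4 * C ι) * b
      + (3 - 2 * (j : ℝ[X])) * X * a - (2 + 4 * C ι) * X * a
      - (3 + 12 * C ι) * (1 - X ^ 2) * e
  have h2 := hs 0
  rw [s0, s1] at h2
  have := h.eq_zero hι.le (by
    simp only [ladder, r0, s0, s1, derivative_mul, derivative_X, derivative_ofNat]
    push_cast
    ring) (by
    simp only [ladder, r1, s1]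
    push_cast at h2 ⊢
    simp only [derivative_ofNat]
    linear_combination h2) j
  linear_combination this

theorem IsAssocRec.derivative_ladder_fst (hr : IsAssocRec ι r)
    (h1 : ∀ j, 2 * (1 - X ^ 2) * derivative (r j) = ladder ι r j + s j) (j : ℕ) :
    2 * (1 - X ^ 2) * derivative (ladder ι r j) =
      ladder ι s j - (2 + 4 * C ι) * X * ladder ι r j
        - (2 * (j : ℝ[X]) - 3) * (2 * (j : ℝ[X]) - 3 + 4 * C ι) * (1 - X ^ 2) * r j := by
  have a := h1 j
  have b := h1 (j + 1)
  have d := hr j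
  simp only [ladder] at a b ⊢
  simp only [derivative_add, derivative_sub, derivative_mul, derivative_C, derivative_X,
    derivative_one, derivative_ofNat, derivative_natCast]
  push_cast at b ⊢
  linear_combination (2 * (j : ℝ[X]) - 3) * X * a - (2 * (j : ℝ[X]) - 1 + 4 * C ι) * b
    + (2 * (j : ℝ[X]) - 1 + 4 * C ι) * d

theorem IsAssocRec.derivative_ladder_snd (hs : IsAssocRec ι s)
    (h2 : ∀ j, 2 * (1 - X ^ 2) * derivative (s j) =
      ladder ι s j + (2 + 4 * C ι) * X * s j + (3 + 12 * C ι) * (1 - X ^ 2) * r j) (j : ℕ) :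
    2 * derivative (ladder ι s j) = (3 + 12 * C ι) * ladder ι r j
        - (2 * (j : ℝ[X]) - 3) * (2 * (j : ℝ[X]) - 3 + 4 * C ι) * s j := by
  have hw : (1 - X ^ 2 : ℝ[X]) ≠ 0 := fun h => by
    have := congrArg (eval 0) h
    simp at this
  refine mul_left_cancel₀ hw ?_
  have a := h2 j
  have b := h2 (j + 1)
  have d := hs j
  simp only [ladder] at a b ⊢
  simp only [derivative_add, derivative_sub, derivative_mul, derivative_C, derivative_X,
    derivative_one, derivative_ofNat, derivative_natCast]
  push_cast at b ⊢
  linear_combination (2 * (j : ℝ[X]) - 3) * X * a - (2 * (j : ℝ[X]) - 1 + 4 * C ι) * b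
    + (2 * (j : ℝ[X]) - 1 + 4 * C ι) * d

end System

/-! ### The ordinary differential equation of the coefficients -/

theorem pPoly_odd (m j : ℕ) : pPoly m (2 * j + 1) = 0 := by
  have key : ∀ j, pPoly m (2 * j + 1) = 0 ∧ pPoly m (2 * j + 3) = 0 := by
    intro j
    induction j with
    | zero => exact ⟨by simp [pPoly], by simp [pPoly]⟩
    | succ j ih =>
      refine ⟨ih.2, ?_⟩
      rw [show 2 * (j + 1) + 3 = (2 * j + 1) + 4 by ring, pPoly,
        show 2 * j + 1 + 2 = 2 * j + 3 by ring, ih.1, ih.2]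
      simp
  exact (key j).1

theorem isAssocRec_pPoly {m : ℕ} (hm : m ≠ 0) :
    IsAssocRec (1 / (m : ℝ)) (fun j => pPoly m (2 * j)) := by
  intro j
  have hm' : (m : ℝ) ≠ 0 := by exact_mod_cast hm
  have h := pPoly_recursion m (2 * j)
  have hC : C (1 / (m : ℝ)) * (m : ℝ[X]) = 1 := by
    rw [← C_eq_natCast, ← C_mul, one_div, inv_mul_cancel₀ hm', C_1]
  simp only [map_add, map_sub, map_mul, map_natCast, map_ofNat, map_one] at h
  push_cast at h
  beta_reduce
  rw [show 2 * (j + 2) = 2 * j + 4 by ring, show 2 * (j + 1) = 2 * j + 2 by ring]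
  -- Divide the recursion by `m`.
  have h' := congrArg (fun q => C (1 / (m : ℝ)) * q) h
  linear_combination h' - ((2 * (j : ℝ[X]) + 1) * pPoly m (2 * j + 4)
    - (4 * (j : ℝ[X]) - 2) * X * pPoly m (2 * j + 2) + (2 * (j : ℝ[X]) - 3) * pPoly m (2 * j)) * hC

/-- The solution of the recursion with initial values `3 c, 3`. It is the difference between
`2 (1 - c²) d/dc` and the ladder operator on `P_{-4,2j}`: the ladder operator differentiates the
Gegenbauer functions but not the `c`-dependent factors by which the initial conditions combine
them. -/
noncomputable def companionPoly (ι : ℝ) : ℕ → ℝ[X]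
  | 0 => 3 * X
  | 1 => 3
  | j + 2 => C ((2 * (j : ℝ) + 1 + 4 * ι)⁻¹) *
      ((4 * (j : ℝ[X]) - 2 + 4 * C ι) * X * companionPoly ι (j + 1)
        - (2 * (j : ℝ[X]) - 3) * companionPoly ι j)

theorem isAssocRec_companionPoly {ι : ℝ} (hι : 0 < ι) : IsAssocRec ι (companionPoly ι) := by
  intro j
  have h : (2 * (j : ℝ) + 1 + 4 * ι) ≠ 0 := by positivity
  have e : (2 * (j : ℝ[X]) + 1 + 4 * C ι) = C (2 * (j : ℝ) + 1 + 4 * ι) := by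
    simp only [map_add, map_mul, map_ofNat, map_natCast, map_one]
  rw [companionPoly, e, ← mul_assoc, ← C_mul, mul_inv_cancel₀ h, C_1, one_mul]

/-- Coefficientwise form of the partial differential equation. -/
theorem pPoly_fourth_order {m : ℕ} (hm : m ≠ 0) (n : ℕ) :
    C ((m : ℝ) ^ 2) * polyOpA (C ((n : ℝ) ^ 2 + 2 * (2 / m - 3) * n + 4 * (1 - 2 / m)))
        (polyOpA (C ((n : ℝ) ^ 2 + 2 * (2 / m - 3) * n + 4 * (1 - 2 / m))) (pPoly m n))
      + C (16 * ((m : ℝ) ^ 2 - 8 * m)) * derivative (derivative (pPoly m n))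
      + C (-16 * (2 - (m : ℝ)) ^ 2) * polyOpE (polyOpE (pPoly m n)) = 0 := by
  rcases Nat.even_or_odd' n with ⟨j, rfl | rfl⟩
  · have hm' : (m : ℝ) ≠ 0 := by exact_mod_cast hm
    set ι : ℝ := 1 / m with hι
    have hι0 : 0 < ι := by positivity
    have hr := isAssocRec_pPoly hm
    have hs := isAssocRec_companionPoly hι0
    have r0 : pPoly m (2 * 0) = 1 := by simp [pPoly]
    have r1 : pPoly m (2 * 1) = 0 := by simp [pPoly]
    have s0 : companionPoly ι 0 = 3 * X := by simp [companionPoly]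
    have s1 : companionPoly ι 1 = 3 := by simp [companionPoly]
    have h1 := hr.derivative_fst hι0 hs r0 r1 s0 s1
    have h2 := hr.derivative_snd hι0 hs r0 r1 s0 s1
    have hμ : C ((2 * (j : ℝ) - 3) * (2 * j - 3 + 4 * ι)) =
        (2 * (j : ℝ[X]) - 3) * (2 * (j : ℝ[X]) - 3 + 4 * C ι) := by
      simp only [map_add, map_sub, map_mul, map_ofNat, map_natCast]
    have key := fourth_order_of_system (μ := (2 * (j : ℝ) - 3) * (2 * j - 3 + 4 * ι)) (h1 j) (h2 j)
      (by rw [hμ]; exact hr.derivative_ladder_fst h1 j)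
      (by rw [hμ]; exact hs.derivative_ladder_snd h2 j)
    have hL : C ((((2 * j : ℕ) : ℝ)) ^ 2 + 2 * (2 / m - 3) * ((2 * j : ℕ) : ℝ) + 4 * (1 - 2 / m)) =
        C ((2 * (j : ℝ) - 3) * (2 * j - 3 + 4 * ι)) - 5 + 4 * C ι := by
      have : C ((2 * (j : ℝ) - 3) * (2 * j - 3 + 4 * ι)) - 5 + 4 * C ι =
          C ((2 * (j : ℝ) - 3) * (2 * j - 3 + 4 * ι) - 5 + 4 * ι) := by
        simp only [map_add, map_sub, map_mul, map_ofNat]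
      rw [this, hι]
      congr 1
      push_cast
      ring
    have c1 : C (16 * ((m : ℝ) ^ 2 - 8 * m)) = C ((m : ℝ) ^ 2) * (16 * (1 - 8 * C ι)) := by
      have : (16 * (1 - 8 * C ι) : ℝ[X]) = C (16 * (1 - 8 * ι)) := by
        simp only [map_sub, map_mul, map_ofNat, map_one]
      rw [this, ← C_mul, hι]
      congr 1
      field_simp
    have c2 : C (-16 * (2 - (m : ℝ)) ^ 2) = C ((m : ℝ) ^ 2) * (-16 * (2 * C ι - 1) ^ 2) := by
      have : (-16 * (2 * C ι - 1) ^ 2 : ℝ[X]) = C (-16 * (2 * ι - 1) ^ 2) := by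
        simp only [map_sub, map_mul, map_neg, map_pow, map_ofNat, map_one]
      rw [this, ← C_mul, hι]
      congr 1
      field_simp
    rw [hL, c1, c2]
    linear_combination C ((m : ℝ) ^ 2) * key
  · simp [pPoly_odd, polyOpA, polyOpE]

/-! ### Bounds for the coefficients -/

theorem tendsto_const_div_linear (u : ℝ) {m : ℕ} (hm : m ≠ 0) :
    Filter.Tendsto (fun j : ℕ => u / ((2 * (j : ℝ) + 1) * m + 4)) Filter.atTop (𝓝 0) := by
  have hm' : (0 : ℝ) < m := by positivity
  refine Filter.Tendsto.const_div_atTop ?_ u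
  refine Filter.tendsto_atTop_mono (fun j => ?_) (tendsto_natCast_atTop_atTop (R := ℝ))
  have h1 : (1 : ℝ) ≤ m := by exact_mod_cast Nat.one_le_iff_ne_zero.2 hm
  have : (0 : ℝ) ≤ j := j.cast_nonneg
  nlinarith

theorem smoothlyBounded_pPoly {m : ℕ} (hm : m ≠ 0) : SmoothlyBounded (pPoly m) := by
  intro k R hR
  have hm' : (0 : ℝ) < m := by positivity
  have h := geomBounded_iterate_derivative_of_recursion (tendsto_const_div_linear (-(2 * m + 2)) hm)
    (tendsto_const_div_linear (-(4 * m + 4)) hm) k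
    (a := fun j => pPoly m (2 * j)) (s := fun _ => 0)
    (fun i _ R _ => ⟨0, by simp⟩)
    (fun j => by
      have e : 2 * (j + 2) = 2 * j + 4 := by ring
      have hpos : (2 * (j : ℝ) + 1) * m + 4 ≠ 0 := by positivity
      have hpos' : 2 * (j : ℝ) * m + m + 4 ≠ 0 := by positivity
      have c1 : 2 * (1 + -(2 * (m : ℝ) + 2) / ((2 * (j : ℝ) + 1) * m + 4)) =
          (2 * (j : ℝ) * m + m + 4)⁻¹ * (2 * ((2 * (j : ℝ) - 1) * m + 2)) := by
        field_simp
        ring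
      have c2 : 1 + -(4 * (m : ℝ) + 4) / ((2 * (j : ℝ) + 1) * m + 4) =
          (2 * (j : ℝ) * m + m + 4)⁻¹ * ((2 * (j : ℝ) - 3) * m) := by
        field_simp
        ring
      rw [e, pPoly, c1, c2]
      simp only [Nat.cast_mul, Nat.cast_ofNat, map_mul, show 2 * (j + 1) = 2 * j + 2 by ring]
      ring) k le_rfl
  obtain ⟨M, hM⟩ := h R hR
  refine ⟨|M|, fun n c hc => ?_⟩
  rcases Nat.even_or_odd' n with ⟨j, rfl | rfl⟩
  · calc _ ≤ M * R ^ j := hM j c hc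
      _ ≤ |M| * R ^ (2 * j) := by
        gcongr
        · exact le_abs_self M
        · exact hR.le
        · omega
  · simp only [pPoly_odd, iterate_derivative_zero, eval_zero, abs_zero]
    positivity

/-! ### The partial differential equation -/

theorem polySeries_add {a b : ℕ → ℝ[X]} (ha : SmoothlyBounded a) (hb : SmoothlyBounded b) {c z : ℝ}
    (hc : c ∈ Set.Ioo (-1 : ℝ) 1) (hz : z ∈ Set.Ioo (-1 : ℝ) 1) :
    polySeries (fun n => a n + b n) c z = polySeries a c z + polySeries b c z := by
  rw [polySeries, polySeries, polySeries,
    ← (ha.geomBounded.summable hc hz).tsum_add (hb.geomBounded.summable hc hz)]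
  simp only [eval_add, add_mul]

theorem polySeries_poly_mul (q : ℝ[X]) (a : ℕ → ℝ[X]) (c z : ℝ) :
    polySeries (fun n => q * a n) c z = q.eval c * polySeries a c z := by
  rw [polySeries, polySeries, ← tsum_mul_left]
  simp only [eval_mul, mul_assoc]

section Operators

variable {F G : ℝ → ℝ → ℝ} {a : ℕ → ℝ[X]}

/-- Two functions of `(c, z)` agree on the open square. The square being open, the partial
derivatives then agree there too. -/
def EqOnSquare (F G : ℝ → ℝ → ℝ) : Prop :=
  ∀ c ∈ Set.Ioo (-1 : ℝ) 1, ∀ z ∈ Set.Ioo (-1 : ℝ) 1, F c z = G c z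

theorem EqOnSquare.partialC (h : EqOnSquare F G) : EqOnSquare (partialC F) (partialC G) :=
  fun _ hc z hz => Filter.EventuallyEq.deriv_eq
    (Filter.eventually_of_mem (isOpen_Ioo.mem_nhds hc) fun s hs => h s hs z hz)

theorem EqOnSquare.partialV (h : EqOnSquare F G) : EqOnSquare (partialV F) (partialV G) :=
  fun c hc z hz => congrArg (z * ·) (Filter.EventuallyEq.deriv_eq
    (Filter.eventually_of_mem (isOpen_Ioo.mem_nhds hz) fun s hs => h c hc s hs))

theorem EqOnSquare.trans {H : ℝ → ℝ → ℝ} (h : EqOnSquare F G) (h' : EqOnSquare G H) :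
    EqOnSquare F H := fun c hc z hz => (h c hc z hz).trans (h' c hc z hz)

theorem EqOnSquare.opA (m : ℕ) (h : EqOnSquare F G) : EqOnSquare (opA m F) (opA m G) :=
  fun c hc z hz => by
    simp only [_root_.opA]
    rw [h.partialC.partialC c hc z hz, h.partialC c hc z hz, h.partialV.partialV c hc z hz,
      h.partialV c hc z hz, h c hc z hz]

theorem EqOnSquare.opE (h : EqOnSquare F G) : EqOnSquare (opE F) (opE G) :=
  fun c hc z hz => by
    simp only [_root_.opE]
    rw [h.partialC c hc z hz, h c hc z hz]

theorem partialC_polySeries (ha : SmoothlyBounded a) :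
    EqOnSquare (partialC (polySeries a)) (polySeries (fun n => derivative (a n))) :=
  fun _ hc _ hz => (hasDerivAt_polySeries_left ha hc hz).deriv

theorem partialV_polySeries (ha : SmoothlyBounded a) :
    EqOnSquare (partialV (polySeries a)) (polySeries (fun n => C (n : ℝ) * a n)) :=
  fun c hc z hz => by
    rw [partialV, (hasDerivAt_polySeries_right ha hc hz).deriv, mul_polySeries_shiftDeriv ha hc hz]

/-- The action of `opA` on the coefficients of a series. -/
noncomputable def coeffOpA (m : ℕ) (a : ℕ → ℝ[X]) (n : ℕ) : ℝ[X] :=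
  4 * (1 - X ^ 2) * derivative (derivative (a n)) + -12 * X * derivative (a n)
    + C (n : ℝ) * (C (n : ℝ) * a n) + C (2 * (2 / (m : ℝ) - 3)) * (C (n : ℝ) * a n)
    + C (4 * (1 - 2 / (m : ℝ))) * a n

theorem coeffOpA_eq (m : ℕ) (a : ℕ → ℝ[X]) (n : ℕ) :
    coeffOpA m a n = polyOpA (C ((n : ℝ) ^ 2 + 2 * (2 / m - 3) * n + 4 * (1 - 2 / m))) (a n) := by
  simp only [coeffOpA, polyOpA, C_add, C_mul (a := _ * _), C_pow]
  ring

theorem SmoothlyBounded.coeffOpA (m : ℕ) (ha : SmoothlyBounded a) :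
    SmoothlyBounded (coeffOpA m a) :=
  ((((ha.derivative.derivative.poly_mul _).add (ha.derivative.poly_mul _)).add
    ha.nat_mul.nat_mul).add (ha.nat_mul.poly_mul _)).add (ha.poly_mul _)

theorem opA_polySeries (m : ℕ) (ha : SmoothlyBounded a) :
    EqOnSquare (opA m (polySeries a)) (polySeries (coeffOpA m a)) := fun c hc z hz => by
  have d1 := ha.derivative.derivative.poly_mul (4 * (1 - X ^ 2))
  have d2 := ha.derivative.poly_mul (-12 * X)
  have d3 := ha.nat_mul.nat_mul
  have d4 := ha.nat_mul.poly_mul (C (2 * (2 / (m : ℝ) - 3)))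
  have d5 := ha.poly_mul (C (4 * (1 - 2 / (m : ℝ))))
  have e : polySeries (_root_.coeffOpA m a) c z = _ :=
    (polySeries_add (((d1.add d2).add d3).add d4) d5 hc hz)
  rw [e, polySeries_add ((d1.add d2).add d3) d4 hc hz, polySeries_add (d1.add d2) d3 hc hz,
    polySeries_add d1 d2 hc hz, polySeries_poly_mul, polySeries_poly_mul, polySeries_poly_mul,
    polySeries_poly_mul, opA,
    ((partialC_polySeries ha).partialC.trans (partialC_polySeries ha.derivative)) c hc z hz,
    partialC_polySeries ha c hc z hz,
    ((partialV_polySeries ha).partialV.trans (partialV_polySeries ha.nat_mul)) c hc z hz,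
    partialV_polySeries ha c hc z hz]
  simp only [eval_mul, eval_sub, eval_pow, eval_X, eval_C, eval_one, eval_ofNat, eval_neg]
  ring

theorem SmoothlyBounded.polyOpE (ha : SmoothlyBounded a) :
    SmoothlyBounded (fun n => polyOpE (a n)) := (ha.derivative.poly_mul X).add ha

theorem opE_polySeries (ha : SmoothlyBounded a) :
    EqOnSquare (opE (polySeries a)) (polySeries (fun n => polyOpE (a n))) := fun c hc z hz => by
  have e : polySeries (fun n => _root_.polyOpE (a n)) c z = _ :=
    polySeries_add (ha.derivative.poly_mul X) ha hc hz
  rw [e, polySeries_poly_mul, opE, partialC_polySeries ha c hc z hz, eval_X]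

end Operators

theorem genP_eq_polySeries (m : ℕ) : genP m = polySeries (pPoly m) := rfl

theorem genP_pde {m : ℕ} (hm : m ≠ 0) {c z : ℝ} (hc : c ∈ Set.Ioo (-1 : ℝ) 1)
    (hz : z ∈ Set.Ioo (-1 : ℝ) 1) :
    (m : ℝ) ^ 2 * opA m (opA m (genP m)) c z
      + 16 * ((m : ℝ) ^ 2 - 8 * (m : ℝ)) * partialC (partialC (genP m)) c z
      - 16 * (2 - (m : ℝ)) ^ 2 * opE (opE (genP m)) c z = 0 := by
  have hp := smoothlyBounded_pPoly hm
  rw [genP_eq_polySeries,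
    ((opA_polySeries m hp).opA m |>.trans (opA_polySeries m (hp.coeffOpA m))) c hc z hz,
    ((partialC_polySeries hp).partialC.trans (partialC_polySeries hp.derivative)) c hc z hz,
    ((opE_polySeries hp).opE.trans (opE_polySeries hp.polyOpE)) c hc z hz]
  have d1 := ((hp.coeffOpA m).coeffOpA m).poly_mul (C ((m : ℝ) ^ 2))
  have d2 := hp.derivative.derivative.poly_mul (C (16 * ((m : ℝ) ^ 2 - 8 * m)))
  have d3 := hp.polyOpE.polyOpE.poly_mul (C (-16 * (2 - (m : ℝ)) ^ 2))
  have e := polySeries_add (d1.add d2) d3 hc hz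
  rw [polySeries_add d1 d2 hc hz, polySeries_poly_mul, polySeries_poly_mul, polySeries_poly_mul,
    eval_C, eval_C, eval_C] at e
  have e0 : polySeries (fun n => C ((m : ℝ) ^ 2) * coeffOpA m (coeffOpA m (pPoly m)) n
      + C (16 * ((m : ℝ) ^ 2 - 8 * m)) * derivative (derivative (pPoly m n))
      + C (-16 * (2 - (m : ℝ)) ^ 2) * polyOpE (polyOpE (pPoly m n))) c z = 0 := by
    simp only [coeffOpA_eq, pPoly_fourth_order hm, polySeries, eval_zero, zero_mul, tsum_zero]
  linear_combination e0 - e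

/-! ### The superelliptic integral -/

/-- The recursion of the coefficients as a first-order differential equation in `z`. -/
theorem genP_ode {m : ℕ} (hm : m ≠ 0) {c z : ℝ} (hc : c ∈ Set.Ioo (-1 : ℝ) 1)
    (hz : z ∈ Set.Ioo (-1 : ℝ) 1) :
    (m : ℝ) * quartic c z * (z * polySeries (shiftDeriv (pPoly m)) c z)
      + ((4 - 3 * m) - 2 * c * (2 - 3 * m) * z ^ 2 - 3 * m * z ^ 4) * genP m c z =
    4 - 3 * m + 2 * c * (3 * m - 2) * z ^ 2 := by
  have hp := smoothlyBounded_pPoly hm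
  have hP : HasSum (fun n : ℕ => (pPoly m n).eval c * z ^ n) (genP m c z) :=
    (hp.geomBounded.summable hc hz).hasSum
  have hQ : HasSum (fun n : ℕ => (C (n : ℝ) * pPoly m n).eval c * z ^ n)
      (z * polySeries (shiftDeriv (pPoly m)) c z) := by
    rw [mul_polySeries_shiftDeriv hp hc hz]
    exact (hp.nat_mul.geomBounded.summable hc hz).hasSum
  have H (v : ℝ) := (hQ.mul_left (m : ℝ)).add (hP.mul_left v)
  have h4 := (hasSum_nat_add_iff' 4).2 (H (4 - 3 * m))
  have h2 := ((hasSum_nat_add_iff' 2).2 (H (2 - 3 * m))).mul_left (2 * c * z ^ 2)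
  have h0 := (H (-3 * m)).mul_left (z ^ 4)
  have key := h4.unique ((h2.sub h0).congr_fun fun k => by
    have h := congrArg (eval c) (pPoly_recursion m k)
    simp only [eval_mul, eval_sub, eval_C, eval_X] at h ⊢
    push_cast
    linear_combination z ^ (k + 4) * h)
  have p0 : pPoly m 0 = 1 := by simp [pPoly]
  have p1 : pPoly m 1 = 0 := by simp [pPoly]
  have p2 : pPoly m 2 = 0 := by simp [pPoly]
  have p3 : pPoly m 3 = 0 := by simp [pPoly]
  simp only [Finset.sum_range_succ, Finset.sum_range_zero, p0, p1, p2, p3, eval_mul, eval_C,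
    eval_one, eval_zero] at key
  push_cast at key
  rw [quartic]
  linear_combination key

theorem quartic_pos {c : ℝ} (hc : c ∈ Set.Ioo (-1 : ℝ) 1) (w : ℝ) : 0 < quartic c w := by
  have : quartic c w = (w ^ 2 - c) ^ 2 + (1 - c) * (1 + c) := by rw [quartic]; ring
  rw [this]
  have := mul_pos (sub_pos.2 hc.2) (neg_lt_iff_pos_add'.1 hc.1)
  positivity

theorem continuous_quartic (c : ℝ) : Continuous (quartic c) := by
  unfold quartic
  fun_prop

/-- The primitive `z ^ (4/m - 3) q ^ (-1/m) P_{-4}` of the superelliptic integrand. -/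
noncomputable def superellipticPrimitive (m : ℕ) (c z : ℝ) : ℝ :=
  z ^ (4 / (m : ℝ) - 3) * quartic c z ^ (-(1 / (m : ℝ))) * genP m c z

theorem hasDerivAt_superellipticPrimitive {m : ℕ} (hm : m ≠ 0) {c z : ℝ}
    (hc : c ∈ Set.Ioo (-1 : ℝ) 1) (hz : z ∈ Set.Ioo (0 : ℝ) 1) :
    HasDerivAt (superellipticPrimitive m c) (superellipticIntegrand m c z) z := by
  have hz' : z ∈ Set.Ioo (-1 : ℝ) 1 := ⟨by linarith [hz.1], hz.2⟩
  have hm' : (m : ℝ) ≠ 0 := by exact_mod_cast hm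
  have hq := quartic_pos hc z
  have dq : HasDerivAt (quartic c) (-4 * c * z + 4 * z ^ 3) z := by
    have h := (((hasDerivAt_pow 2 z).const_mul (2 * c)).const_sub 1).add (hasDerivAt_pow 4 z)
    convert! h using 1
    norm_num
    ring
  have dP := hasDerivAt_polySeries_right (smoothlyBounded_pPoly hm) hc hz'
  have d := ((Real.hasDerivAt_rpow_const (p := 4 / (m : ℝ) - 3) (Or.inl hz.1.ne')).mul
    (dq.rpow_const (p := -(1 / (m : ℝ))) (Or.inl hq.ne'))).mul dP
  refine HasDerivAt.congr_deriv d ?_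
  set W := z ^ (4 - 4 / (m : ℝ)) with hW
  set V := quartic c z ^ (1 + 1 / (m : ℝ)) with hV
  have hWpos : 0 < W := Real.rpow_pos_of_pos hz.1 _
  have hVpos : 0 < V := Real.rpow_pos_of_pos hq _
  have w1 : z ^ (4 / (m : ℝ) - 3 - 1) = W⁻¹ := by
    rw [hW, ← Real.rpow_neg hz.1.le]; congr 1; ring
  have w2 : z ^ (4 / (m : ℝ) - 3) = z * W⁻¹ := by
    rw [← w1, Real.rpow_sub_one hz.1.ne', mul_div_cancel₀ _ hz.1.ne']
  have v1 : quartic c z ^ (-(1 / (m : ℝ)) - 1) = V⁻¹ := by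
    rw [hV, ← Real.rpow_neg hq.le]; congr 1; ring
  have v2 : quartic c z ^ (-(1 / (m : ℝ))) = quartic c z * V⁻¹ := by
    rw [← v1, Real.rpow_sub_one hq.ne', mul_div_cancel₀ _ hq.ne']
  have ode := genP_ode hm hc hz'
  rw [genP_eq_polySeries] at ode
  simp only [superellipticIntegrand, Pi.mul_apply]
  rw [w1, w2, v1, v2, ← hW, ← hV, ← ode]
  field_simp
  rw [quartic]
  ring

theorem continuousOn_superellipticIntegrand {m : ℕ} (hm : m ≠ 0) {c : ℝ}
    (hc : c ∈ Set.Ioo (-1 : ℝ) 1) : ContinuousOn (superellipticIntegrand m c) (Set.Ioi 0) := by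
  have hm' : (0 : ℝ) < m := by positivity
  unfold superellipticIntegrand
  refine ContinuousOn.div (by fun_prop) (ContinuousOn.mul (continuousOn_const.mul
    (continuousOn_id.rpow_const fun w hw => Or.inl (ne_of_gt hw)))
    ((continuous_quartic c).continuousOn.rpow_const fun w _ => Or.inl (quartic_pos hc w).ne'))
    fun w hw => ?_
  have h1 := Real.rpow_pos_of_pos (Set.mem_Ioi.1 hw) (4 - 4 / (m : ℝ))
  have h2 := Real.rpow_pos_of_pos (quartic_pos hc w) (1 + 1 / (m : ℝ))
  exact (mul_pos (mul_pos hm' h1) h2).ne'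

/-- A second-order bound for `q ^ (-p)` at `q = 1`, from Bernoulli's inequality for the
exponent `p` applied to `q` and to `1 / q`. -/
theorem abs_rpow_neg_sub_le {p q : ℝ} (hp0 : 0 ≤ p) (hp1 : p ≤ 1) (hq : 0 < q) :
    |q ^ (-p) - 1 + p * (q - 1)| ≤ p * (q - 1) ^ 2 / q := by
  have hqp : 0 < q ^ p := Real.rpow_pos_of_pos hq p
  have hle : q ^ p ≤ 1 + p * (q - 1) := by
    simpa using rpow_one_add_le_one_add_mul_self (s := q - 1) (by linarith) hp0 hp1
  have hup : q ^ (-p) ≤ 1 + p * (q⁻¹ - 1) := by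
    have h := rpow_one_add_le_one_add_mul_self (s := q⁻¹ - 1)
      (by linarith [inv_pos.2 hq]) hp0 hp1
    rwa [add_sub_cancel, Real.inv_rpow hq.le, ← Real.rpow_neg hq.le] at h
  have hlow : 1 - p * (q - 1) ≤ q ^ (-p) := by
    rw [Real.rpow_neg hq.le, ← one_div, le_div_iff₀ hqp]
    by_cases h : 1 - p * (q - 1) ≤ 0
    · exact (mul_nonpos_of_nonpos_of_nonneg h hqp.le).trans zero_le_one
    · have := mul_le_mul_of_nonneg_left hle (not_le.1 h).le
      nlinarith [sq_nonneg (p * (q - 1))]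
  have e : p * (q - 1) ^ 2 / q = p * (q⁻¹ - 1) + p * (q - 1) := by
    field_simp
    ring
  rw [abs_of_nonneg (by linarith), e]
  linarith

open Asymptotics in
/-- The coefficients at `ε ^ 0` and `ε ^ 2` of `q ^ (-1/m) P_{-4}` are `1` and `2 c / m`. -/
theorem isBigO_rpow_mul_genP_sub {m : ℕ} (hm : m ≠ 0) {c : ℝ} (hc : c ∈ Set.Ioo (-1 : ℝ) 1) :
    (fun ε => quartic c ε ^ (-(1 / (m : ℝ))) * genP m c ε - 1 - 2 * c / m * ε ^ 2)
      =O[𝓝 0] fun ε => ε ^ 4 := by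
  have hp := smoothlyBounded_pPoly hm
  have hm1 : (1 : ℝ) ≤ m := by exact_mod_cast Nat.one_le_iff_ne_zero.2 hm
  have zero_mem : (0 : ℝ) ∈ Set.Ioo (-1 : ℝ) 1 := by norm_num
  have hgenP : ∀ᶠ ε in 𝓝 (0 : ℝ),
      genP m c ε = 1 + polySeries (fun n => pPoly m (n + 4)) c ε * ε ^ 4 := by
    filter_upwards [isOpen_Ioo.mem_nhds zero_mem] with ε hε
    rw [genP, ← (hp.geomBounded.summable hc hε).sum_add_tsum_nat_add 4, polySeries,
      ← tsum_mul_right]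
    congr 1
    · simp [Finset.sum_range_succ, pPoly]
    · exact tsum_congr fun n => by ring
  have hcq : Continuous fun ε => quartic c ε ^ (-(1 / (m : ℝ))) :=
    (continuous_quartic c).rpow_const fun w => Or.inl (quartic_pos hc w).ne'
  have b1 : (fun ε => quartic c ε ^ (-(1 / (m : ℝ))) * polySeries (fun n => pPoly m (n + 4)) c ε
      * ε ^ 4) =O[𝓝 0] fun ε => ε ^ 4 := by
    have h : ContinuousAt (fun ε => quartic c ε ^ (-(1 / (m : ℝ)))
        * polySeries (fun n => pPoly m (n + 4)) c ε) 0 :=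
      hcq.continuousAt.mul
        (hasDerivAt_polySeries_right hp.succ.succ.succ.succ hc zero_mem).continuousAt
    simpa using (h.isBigO_one ℝ).mul (isBigO_refl (fun ε : ℝ => ε ^ 4) (𝓝 0))
  have b2 : (fun ε => quartic c ε ^ (-(1 / (m : ℝ))) - 1 + 1 / (m : ℝ) * (quartic c ε - 1))
      =O[𝓝 0] fun ε => ε ^ 4 := by
    have h : ContinuousAt (fun ε => 1 / (m : ℝ) * (ε ^ 2 - 2 * c) ^ 2 / quartic c ε) 0 :=
      ContinuousAt.div (by fun_prop) (continuous_quartic c).continuousAt (quartic_pos hc 0).ne'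
    have h' := (h.isBigO_one ℝ).mul (isBigO_refl (fun ε : ℝ => ε ^ 4) (𝓝 0))
    simp only [one_mul] at h'
    refine (IsBigO.of_bound 1 (Filter.Eventually.of_forall fun ε => ?_)).trans h'
    rw [one_mul, Real.norm_eq_abs]
    refine (abs_rpow_neg_sub_le (by positivity) ((div_le_one (by linarith)).2 hm1)
      (quartic_pos hc ε)).trans ((le_abs_self _).trans_eq' ?_)
    rw [show quartic c ε - 1 = ε ^ 2 * (ε ^ 2 - 2 * c) by rw [quartic]; ring]
    ring
  have b3 : (fun ε : ℝ => 1 / (m : ℝ) * ε ^ 4) =O[𝓝 0] fun ε => ε ^ 4 :=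
    isBigO_const_mul_self _ _ _
  refine ((b1.add b2).sub b3).congr' ?_ Filter.EventuallyEq.rfl
  filter_upwards [hgenP] with ε hε
  rw [hε, quartic]
  ring

theorem tendsto_superelliptic {m : ℕ} (hm : m ≠ 0) {c z : ℝ} (hc : c ∈ Set.Ioo (-1 : ℝ) 1)
    (hz : z ∈ Set.Ioo (0 : ℝ) 1) :
    Filter.Tendsto (fun ε : ℝ => (∫ w in ε..z, superellipticIntegrand m c w)
      + ε ^ (4 / (m : ℝ) - 3) + 2 * c / (m : ℝ) * ε ^ (4 / (m : ℝ) - 1))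
      (𝓝[>] 0) (𝓝 (superellipticPrimitive m c z)) := by
  have hm' : (0 : ℝ) < m := by positivity
  set f : ℝ → ℝ := fun ε =>
    quartic c ε ^ (-(1 / (m : ℝ))) * genP m c ε - 1 - 2 * c / m * ε ^ 2 with hf
  have hsmall : Filter.Tendsto (fun ε : ℝ => ε ^ (4 / (m : ℝ) - 3) * f ε) (𝓝[>] 0) (𝓝 0) := by
    have h1 := (Asymptotics.isBigO_refl (fun ε : ℝ => ε ^ (4 / (m : ℝ) - 3)) (𝓝[>] 0)).mul
      ((isBigO_rpow_mul_genP_sub hm hc).mono nhdsWithin_le_nhds)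
    refine h1.trans_tendsto ?_
    have h2 : Filter.Tendsto (fun ε : ℝ => ε ^ (4 / (m : ℝ) + 1)) (𝓝[>] 0) (𝓝 0) := by
      have h : ContinuousAt (fun ε : ℝ => ε ^ (4 / (m : ℝ) + 1)) 0 :=
        Real.continuousAt_rpow_const _ _ (Or.inr (by positivity))
      have h' := h.tendsto
      rw [Real.zero_rpow (by positivity)] at h'
      exact h'.mono_left nhdsWithin_le_nhds
    refine h2.congr' ?_
    filter_upwards [self_mem_nhdsWithin] with ε hε
    rw [← Real.rpow_natCast, ← Real.rpow_add hε]
    congr 1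
    push_cast
    ring
  have hlim := hsmall.const_sub (superellipticPrimitive m c z)
  rw [sub_zero] at hlim
  refine hlim.congr' ?_
  filter_upwards [Ioo_mem_nhdsGT hz.1] with ε hε
  have hIcc : Set.uIcc ε z = Set.Icc ε z := Set.uIcc_of_le hε.2.le
  have hint : ∫ w in ε..z, superellipticIntegrand m c w =
      superellipticPrimitive m c z - superellipticPrimitive m c ε := by
    refine intervalIntegral.integral_eq_sub_of_hasDerivAt (fun w hw => ?_) ?_
    · rw [hIcc] at hw
      exact hasDerivAt_superellipticPrimitive hm hc
        ⟨hε.1.trans_le hw.1, hw.2.trans_lt hz.2⟩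
    · refine ((continuousOn_superellipticIntegrand hm hc).mono ?_).intervalIntegrable
      rw [hIcc]
      exact fun w hw => hε.1.trans_le hw.1
  have hpow : ε ^ (4 / (m : ℝ) - 1) = ε ^ (4 / (m : ℝ) - 3) * ε ^ 2 := by
    rw [← Real.rpow_natCast, ← Real.rpow_add hε.1]
    congr 1
    push_cast
    ring
  rw [hint, hpow, hf]
  simp only [superellipticPrimitive]
  ring

theorem genP_eq_mul_superellipticPrimitive {m : ℕ} {c z : ℝ}
    (hc : c ∈ Set.Ioo (-1 : ℝ) 1) (hz : 0 < z) :
    genP m c z =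
      z ^ (3 - 4 / (m : ℝ)) * quartic c z ^ (1 / (m : ℝ)) * superellipticPrimitive m c z := by
  have hq := quartic_pos hc z
  have h1 : z ^ (3 - 4 / (m : ℝ)) * z ^ (4 / (m : ℝ) - 3) = 1 := by
    rw [← Real.rpow_add hz]; simp
  have h2 : quartic c z ^ (1 / (m : ℝ)) * quartic c z ^ (-(1 / (m : ℝ))) = 1 := by
    rw [← Real.rpow_add hq]; simp
  rw [superellipticPrimitive]
  linear_combination (-genP m c z) * h1
    - z ^ (3 - 4 / (m : ℝ)) * z ^ (4 / (m : ℝ) - 3) * genP m c z * h2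

theorem shiftDeriv_iterate_pPoly (m : ℕ) :
    (shiftDeriv^[1] (pPoly m)) 0 = 0 ∧ (shiftDeriv^[2] (pPoly m)) 0 = 0 ∧
      (shiftDeriv^[3] (pPoly m)) 0 = 0 := by
  simp [shiftDeriv, pPoly]

theorem mainTheorem2 (m : ℕ) (hm : 2 ≤ m) :
    -- the generating series converges, and its sum is smooth
    (∀ c ∈ Set.Ioo (-1 : ℝ) 1, ∀ z ∈ Set.Ioo (-1 : ℝ) 1,
      Summable (fun n : ℕ => (pPoly m n).eval c * z ^ n)) ∧
    ContDiffOn ℝ ∞ (fun p : ℝ × ℝ => genP m p.1 p.2)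
      (Set.Ioo (-1 : ℝ) 1 ×ˢ Set.Ioo (-1 : ℝ) 1) ∧
    -- it is given by a superelliptic integral
    (∀ c ∈ Set.Ioo (-1 : ℝ) 1, ∀ z ∈ Set.Ioo (0 : ℝ) 1, ∃ l : ℝ,
      Filter.Tendsto
        (fun ε : ℝ => (∫ w in ε..z, superellipticIntegrand m c w)
          + ε ^ (4 / (m : ℝ) - 3) + 2 * c / (m : ℝ) * ε ^ (4 / (m : ℝ) - 1))
        (𝓝[>] 0) (𝓝 l) ∧
      genP m c z = z ^ (3 - 4 / (m : ℝ)) * quartic c z ^ (1 / (m : ℝ)) * l) ∧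
    -- the fourth-order linear PDE
    (∀ c ∈ Set.Ioo (-1 : ℝ) 1, ∀ z ∈ Set.Ioo (0 : ℝ) 1,
      (m : ℝ) ^ 2 * opA m (opA m (genP m)) c z
        + 16 * ((m : ℝ) ^ 2 - 8 * (m : ℝ)) * partialC (partialC (genP m)) c z
        - 16 * (2 - (m : ℝ)) ^ 2 * opE (opE (genP m)) c z = 0) ∧
    -- the boundary conditions at z = 0
    (∀ c ∈ Set.Ioo (-1 : ℝ) 1,
      genP m c 0 = 1 ∧
      iteratedDeriv 1 (fun z => genP m c z) 0 = 0 ∧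
      iteratedDeriv 2 (fun z => genP m c z) 0 = 0 ∧
      iteratedDeriv 3 (fun z => genP m c z) 0 = 0) := by
  have hm0 : m ≠ 0 := by omega
  have hp := smoothlyBounded_pPoly hm0
  refine ⟨fun c hc z hz => hp.geomBounded.summable hc hz, contDiffOn_polySeries hp,
    fun c hc z hz => ⟨superellipticPrimitive m c z, tendsto_superelliptic hm0 hc hz,
      genP_eq_mul_superellipticPrimitive hc hz.1⟩,
    fun c hc z hz => genP_pde hm0 hc ⟨by linarith [hz.1], hz.2⟩, fun c hc => ?_⟩
  have h0 : (0 : ℝ) ∈ Set.Ioo (-1 : ℝ) 1 := by norm_num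
  obtain ⟨h1, h2, h3⟩ := shiftDeriv_iterate_pPoly m
  simp only [genP_eq_polySeries, iteratedDeriv_polySeries_right hp _ hc h0, polySeries_zero_right,
    h1, h2, h3, eval_zero, and_self, and_true]
  simp [pPoly]
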